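/- Conventions. $\mathbb N=\{0,1,2,\dots\}$. Let $K$ be a field with algebraic closure $\overline K$. A sequence $a\in K^{\mathbb N}$ is a recurrence sequence if there are an integer $m\ge 0$ and $\gamma_0,\dots,\gamma_{m-1}\in K$ with $a(n+m)=\gamma_{m-1}a(n+m-1)+\dots+\gamma_0a(n)$ for all $n\in\mathbb N$; the smallest such $m$ is its order. Put $\mathcal Z(a)=\{n\in\mathbb N : a(n)=0\}$ and let $P_a\in K[E]$ be the minimum polynomial of $a$, i.e. the monic generator of the ideal of all $P\in K[E]$ with $P(E)a=0$, where $(Ea)(n)=a(n+1)$. The sequence $a$ is simple if all roots of $P_a$ in $\overline K$ are distinct (have multiplicity one), and nondegenerate if all roots of $P_a$ in $\overline K$ are nonzero and the quotient of any two distinct roots is not a root of unity. Let $p$ be a prime. An elementary $p$-nested set of order $r\ge 1$ is a set of the form $$S_q(c_0;c_1,\dots,c_r)=\{c_0+c_1q^{k_1}+\dots+c_rq^{k_r} : k_1,\dots,k_r\in\mathbb N\}\cap\mathbb N,$$ where $q=p^e$ for some integer $e\ge 1$, and $c_0,\dots,c_r\in\mathbb Q$ satisfy $(q-1)c_i\in\mathbb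 Z$ for $0\le i\le r$, $c_0+\dots+c_r\in\mathbb Z$, $c_i\ne 0$ for $1\le i\le r$, and $c_i>0$ for some $i$ with $1\le i\le r$. For an integer $D$, a $p$-nested set of order $\le D$ is a union of a finite set and finitely many elementary $p$-nested sets of orders $\le D$ (so for $D\le 0$ it is just a finite set). An infinite arithmetic progression is a set $m+n\mathbb N$ with $m\in\mathbb N$ and $n$ a positive integer. Theorem. Let $K$ be a field of characteristic $p>0$ and let $a\in K^{\mathbb N}$ be a nonzero, simple and nondegenerate recurrence sequence of order $d$. Then $\mathcal Z(a)$ is a $p$-nested set of order $\le d-2$. In particular, $\mathcal Z(a)$ contains no infinite arithmetic progression. -/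

import Mathlib

open Polynomial

noncomputable section

namespace SkolemMahlerLech

section Recurrence

variable {K : Type*} [Field K]

/-- `a` satisfies a `K`-recurrence relation of order `d`:
`a (n + d) = γ₀ a n + ⋯ + γ_{d-1} a (n + d - 1)` for all `n`. -/
def SatisfiesRecurrence (a : ℕ → K) (d : ℕ) : Prop :=
  ∃ L : LinearRecurrence K, L.order = d ∧ L.IsSolution a

/-- `a` is a `K`-recurrence sequence whose order, i.e. the smallest order of a
recurrence relation satisfied by `a`, is `d`. -/
def IsRecurrenceSeqOfOrder (a : ℕ → K) (d : ℕ) : Prop :=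
  IsLeast {m : ℕ | SatisfiesRecurrence a m} d

/-- The set of zeroes of a sequence. -/
def zeroSet (a : ℕ → K) : Set ℕ := {n | a n = 0}

variable (K) in
/-- The shift operator `(E a) n = a (n + 1)`. -/
def shift : Module.End K (ℕ → K) where
  toFun a := fun n => a (n + 1)
  map_add' _ _ := rfl
  map_smul' _ _ := rfl

/-- The ideal of all polynomials `P` with `P(E) a = 0`. -/
def annIdeal (a : ℕ → K) : Ideal K[X] where
  carrier := {P | aeval (shift K) P a = 0}
  zero_mem' := by simp
  add_mem' := by
    intro P Q hP hQ
    simp only [Set.mem_ofPred_eq] at hP hQ ⊢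
    simp [hP, hQ]
  smul_mem' := by
    intro P Q hQ
    simp only [Set.mem_ofPred_eq] at hQ ⊢
    simp [hQ]

open scoped Classical in
/-- The minimum polynomial of `a`: the monic generator of `annIdeal a`
(and `0` if `a` is not a recurrence sequence). -/
def minPolynomial (a : ℕ → K) : K[X] :=
  normalize (Submodule.IsPrincipal.generator (annIdeal a))

theorem minPolynomial_dvd_iff (a : ℕ → K) (P : K[X]) :
    minPolynomial a ∣ P ↔ aeval (shift K) P a = 0 := by
  classical
  have h : P ∈ annIdeal a ↔ aeval (shift K) P a = 0 := Iff.rfl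
  rw [← h, Submodule.IsPrincipal.mem_iff_generator_dvd (annIdeal a), minPolynomial]
  exact normalize_dvd_iff

theorem minPolynomial_monic (a : ℕ → K) (h : annIdeal a ≠ ⊥) : (minPolynomial a).Monic := by
  classical
  unfold minPolynomial
  apply Polynomial.monic_normalize
  intro h0
  exact h ((Submodule.IsPrincipal.eq_bot_iff_generator_eq_zero _).2 h0)

/-- All roots of the minimum polynomial (in the algebraic closure of `K`) are nonzero, and
the quotient of any two distinct roots is not a root of unity. -/
def IsNondegenerate (a : ℕ → K) : Prop :=
  (∀ α : AlgebraicClosure K, aeval α (minPolynomial a) = 0 → α ≠ 0) ∧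
  ∀ α β : AlgebraicClosure K, aeval α (minPolynomial a) = 0 → aeval β (minPolynomial a) = 0 →
    α ≠ β → ∀ n : ℕ, 0 < n → (α / β) ^ n ≠ 1

/-- All roots of the minimum polynomial (in the algebraic closure of `K`) are distinct. -/
def IsSimple (a : ℕ → K) : Prop :=
  ((minPolynomial a).aroots (AlgebraicClosure K)).Nodup

end Recurrence

/-- An infinite arithmetic progression `m + n ℕ`, with `n` positive. -/
def IsInfiniteAP (A : Set ℕ) : Prop :=
  ∃ m n : ℕ, 0 < n ∧ A = {x | ∃ k : ℕ, x = m + n * k}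

/-- The set of all `c₀ + c₁ q ^ k₁ + ⋯ + c_d q ^ k_d` with `k₁, …, k_d ∈ ℕ`. -/
def nestedRat (q : ℕ) {d : ℕ} (c₀ : ℚ) (c : Fin d → ℚ) : Set ℚ :=
  {x | ∃ k : Fin d → ℕ, x = c₀ + ∑ i, c i * (q : ℚ) ^ k i}

/-- The set `S_q(c₀; c₁, …, c_d)` of natural numbers in `nestedRat q c₀ c`. -/
def nestedSet (q : ℕ) {d : ℕ} (c₀ : ℚ) (c : Fin d → ℚ) : Set ℕ :=
  {n | (n : ℚ) ∈ nestedRat q c₀ c}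

/-- The conditions on the parameters of `S_q(c₀; c₁, …, c_d)`. -/
structure IsAdmissible (q : ℕ) {d : ℕ} (c₀ : ℚ) (c : Fin d → ℚ) : Prop where
  int_zero : ∃ z : ℤ, ((q : ℚ) - 1) * c₀ = z
  int : ∀ i, ∃ z : ℤ, ((q : ℚ) - 1) * c i = z
  int_sum : ∃ z : ℤ, c₀ + ∑ i, c i = z
  ne_zero : ∀ i, c i ≠ 0

/-- `A` is an elementary `p`-nested set of order `d`. -/
def IsElementaryPNested (p d : ℕ) (A : Set ℕ) : Prop :=
  1 ≤ d ∧ ∃ e : ℕ, 1 ≤ e ∧ ∃ (c₀ : ℚ) (c : Fin d → ℚ),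
    IsAdmissible (p ^ e) c₀ c ∧ (∃ i, 0 < c i) ∧ A = nestedSet (p ^ e) c₀ c

/-- `A` is a `p`-nested set of order `≤ D`: the union of a finite set and finitely many
elementary `p`-nested sets of order `≤ D`. The bound is an integer, so that `D ≤ 0` means
that `A` is finite. -/
def IsPNestedOfOrderLE (p : ℕ) (D : ℤ) (A : Set ℕ) : Prop :=
  ∃ (F : Set ℕ) (C : Set (Set ℕ)), F.Finite ∧ C.Finite ∧
    (∀ B ∈ C, ∃ r : ℕ, (r : ℤ) ≤ D ∧ IsElementaryPNested p r B) ∧ A = F ∪ ⋃₀ C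

end SkolemMahlerLech

end

/-!
# Zeros of simple nondegenerate recurrence sequences in characteristic `p`

Write the sequence as a power sum `a n = ∑ uᵢ αᵢ ^ n` over the algebraic closure, with nonzero `αᵢ`
whose ratios are not roots of unity. Then `n` is a zero iff the vector `α ^ n` lies in a hyperplane
`V` of `L ^ ι`, where `L` is the field generated by the `αᵢ` and `uᵢ`. Reading off the lowest base
`p` digit of `n = r + p n'` gives `α ^ n ∈ V ↔ α ^ n' ∈ V'`, where `V' = {x | α ^ r x ^ p ∈ V}`
(`frobPull`), a subspace of at most the same dimension.

* Only finitely many subspaces occur (`exists_finite_stable_submodules`). Expressing a linear form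
  in a basis of `L` over its subfield of `p`-th powers divides the degrees of its coefficients in
  the generators of `L` by `p`, up to a bounded error and a common denominator.
* Hence bounded numbers of digits lead to a periodic subspace `W = {x | α ^ r x ^ q ∈ W}`, for a
  common power `q` of `p` (`exists_isPeriodic`). If the digits of `n` leave the period of `W`, the
  next periodic subspace has smaller dimension: otherwise some `α ^ m`, `m > 0`, would stabilize
  `W`, and since `W` contains `α ^ n`, a vector without zero coordinates, a Vandermonde argument
  forces `W` to be the whole space (`finrank_lt_of_isPeriodic`).
* By induction on the dimension, the elements `n` of the zero set are of the form
  `(q - 1) n = b₀ + ∑ bᵢ q ^ kᵢ` with fewer exponents than the dimension, each exponent `k`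
  counting the repetitions of a period (`coveredByPatterns_of_isPeriodic`).
* In this description the exponents are ordered. The ordering can be dropped: a linear relation
  among the vectors `C ^ (q ^ m)` that holds for all large `m` holds for all `m`, because
  all tails of this sequence have the same span (`mem_zeros_of_eventually`).

A hyperplane in dimension at most `d` thus gives at most `d - 2` exponents. An infinite arithmetic
progression of zeros is excluded by the Vandermonde argument alone.
-/

namespace SkolemMahlerLech

theorem single_one_eq_ite {ι L : Type*} [DecidableEq ι] [Zero L] [One L] (i : ι) :
    (Pi.single i 1 : ι → L) = fun j => if i = j then 1 else 0 := by
  funext j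
  simp [Pi.single_apply, eq_comm]

/-! ### Pulling back and pushing forward along Frobenius -/

section Frobenius

variable {L : Type*} [Field L] (p : ℕ) [Fact p.Prime] [CharP L p] {ι : Type*} (α : ι → L)

/-- The vectors `x` with `α ^ r * x ^ (p ^ e) ∈ V` (coordinatewise), a subspace because
`x ↦ x ^ (p ^ e)` is a ring homomorphism. -/
def frobPull (e r : ℕ) (V : Submodule L (ι → L)) : Submodule L (ι → L) where
  carrier := {x | (fun i => α i ^ r * x i ^ p ^ e) ∈ V}
  add_mem' := by
    intro x y hx hy
    have h := V.add_mem hx hy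
    simp only [Set.mem_ofPred_eq] at *
    convert h using 1
    funext i
    simp [add_pow_char_pow, mul_add]
  zero_mem' := by
    have : p ≠ 0 := (Fact.out : p.Prime).ne_zero
    simp only [Set.mem_ofPred_eq]
    convert V.zero_mem using 1
    funext i
    simp [this]
  smul_mem' := by
    intro c x hx
    have h := V.smul_mem (c ^ p ^ e) hx
    simp only [Set.mem_ofPred_eq] at *
    convert h using 1
    funext i
    simp only [Pi.smul_apply, smul_eq_mul]
    ring

variable {p α}

theorem mem_frobPull {e r : ℕ} {V : Submodule L (ι → L)} {x : ι → L} :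
    x ∈ frobPull p α e r V ↔ (fun i => α i ^ r * x i ^ p ^ e) ∈ V := Iff.rfl

variable (p α)

/-- The span of the vectors `α ^ r * x ^ (p ^ e)` with `x ∈ X`. -/
def frobPush (e r : ℕ) (X : Submodule L (ι → L)) : Submodule L (ι → L) :=
  Submodule.span L ((fun (x : ι → L) i => α i ^ r * x i ^ p ^ e) '' X)

variable {p α}

theorem frobPush_le_iff {e r : ℕ} {X V : Submodule L (ι → L)} :
    frobPush p α e r X ≤ V ↔ X ≤ frobPull p α e r V := by
  rw [frobPush, Submodule.span_le, Set.image_subset_iff]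
  rfl

theorem frobPull_frobPull (e r f s : ℕ) (V : Submodule L (ι → L)) :
    frobPull p α f s (frobPull p α e r V) = frobPull p α (e + f) (r + p ^ e * s) V := by
  ext x
  simp only [mem_frobPull]
  have : (fun i => α i ^ r * (α i ^ s * x i ^ p ^ f) ^ p ^ e) =
      fun i => α i ^ (r + p ^ e * s) * x i ^ p ^ (e + f) := by
    funext i
    rw [mul_pow, ← pow_mul, ← pow_mul, pow_add, pow_add]
    ring
  rw [this]

theorem frobPull_zero_zero (V : Submodule L (ι → L)) : frobPull p α 0 0 V = V := by
  ext x
  simp [mem_frobPull]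

theorem frobPush_frobPush (e r f s : ℕ) (X : Submodule L (ι → L)) :
    frobPush p α e r (frobPush p α f s X) = frobPush p α (e + f) (r + p ^ e * s) X := by
  refine eq_of_forall_ge_iff fun V => ?_
  rw [frobPush_le_iff, frobPush_le_iff, frobPush_le_iff, frobPull_frobPull]

/-- Raising coordinates to the power `p ^ e` preserves linear independence. -/
theorem linearIndependent_pow [Fintype ι] {κ : Type*} [Fintype κ] {v : κ → ι → L}
    (hv : LinearIndependent L v) (hα : ∀ i, α i ≠ 0) (e r : ℕ) :
    LinearIndependent L (fun j i => α i ^ r * v j i ^ p ^ e) := by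
  classical
  have hinj : LinearMap.ker (Fintype.linearCombination L v) = ⊥ :=
    LinearMap.ker_eq_bot.2 (linearIndependent_iff_injective_fintypeLinearCombination.1 hv)
  obtain ⟨g, hg⟩ := LinearMap.exists_leftInverse_of_injective _ hinj
  have hgv : ∀ j, g (v j) = Pi.single j 1 := fun j => by
    have := LinearMap.congr_fun hg (Pi.single j 1)
    simpa using this
  have hgsum : ∀ j k, ∑ i, v j i * g (Pi.single i 1) k = (Pi.single j 1 : κ → L) k := fun j k => by
    rw [← hgv j, LinearMap.pi_apply_eq_sum_univ g (v j)]
    simp [Finset.sum_apply, single_one_eq_ite]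
  have hp : p ^ e ≠ 0 := pow_ne_zero _ (Fact.out : p.Prime).ne_zero
  rw [Fintype.linearIndependent_iff]
  intro c hc k
  have hci : ∀ i, ∑ j, c j * v j i ^ p ^ e = 0 := fun i => by
    have := congr_fun hc i
    simp only [Finset.sum_apply, Pi.smul_apply, smul_eq_mul, Pi.zero_apply] at this
    have h2 : α i ^ r * ∑ j, c j * v j i ^ p ^ e = 0 := by
      rw [← this, Finset.mul_sum]
      exact Finset.sum_congr rfl fun _ _ => by ring
    exact (mul_eq_zero.1 h2).resolve_left (pow_ne_zero _ (hα i))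
  calc c k = ∑ j, c j * ((Pi.single j 1 : κ → L) k) ^ p ^ e := by
        rw [Finset.sum_eq_single k]
        · simp
        · intro j _ hj
          rw [Pi.single_eq_of_ne hj.symm, zero_pow hp, mul_zero]
        · simp
    _ = ∑ j, c j * ∑ i, v j i ^ p ^ e * (g (Pi.single i 1) k) ^ p ^ e := by
        refine Finset.sum_congr rfl fun j _ => ?_
        rw [← hgsum, sum_pow_char_pow]
        simp only [mul_pow]
    _ = ∑ i, (g (Pi.single i 1) k) ^ p ^ e * ∑ j, c j * v j i ^ p ^ e := by
        simp only [Finset.mul_sum]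
        rw [Finset.sum_comm]
        exact Finset.sum_congr rfl fun _ _ => Finset.sum_congr rfl fun _ _ => by ring
    _ = 0 := by simp [hci]

theorem finrank_le_finrank_frobPush [Fintype ι] (hα : ∀ i, α i ≠ 0) (e r : ℕ)
    (X : Submodule L (ι → L)) :
    Module.finrank L X ≤ Module.finrank L (frobPush p α e r X) := by
  let b := Module.finBasis L X
  have hb : LinearIndependent L (fun j => (b j : ι → L)) :=
    b.linearIndependent.map' X.subtype X.ker_subtype
  have h := linearIndependent_pow (p := p) hb hα e r
  have h2 : LinearIndependent L (fun j => (⟨fun i => α i ^ r * (b j : ι → L) i ^ p ^ e,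
      Submodule.subset_span ⟨b j, (b j).2, rfl⟩⟩ : frobPush p α e r X)) :=
    LinearIndependent.of_comp (frobPush p α e r X).subtype h
  simpa using h2.fintype_card_le_finrank

theorem finrank_frobPull_le [Fintype ι] (hα : ∀ i, α i ≠ 0) (e r : ℕ)
    (V : Submodule L (ι → L)) :
    Module.finrank L (frobPull p α e r V) ≤ Module.finrank L V :=
  (finrank_le_finrank_frobPush hα e r _).trans
    (Submodule.finrank_mono (frobPush_le_iff.2 le_rfl))

/-- If pulling back does not lower the dimension, then the subspace is recovered from its
pullback. -/
theorem frobPush_frobPull_eq [Fintype ι] (hα : ∀ i, α i ≠ 0) {e r : ℕ}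
    {V : Submodule L (ι → L)}
    (h : Module.finrank L V ≤ Module.finrank L (frobPull p α e r V)) :
    frobPush p α e r (frobPull p α e r V) = V :=
  Submodule.eq_of_le_of_finrank_le (frobPush_le_iff.2 le_rfl)
    (h.trans (finrank_le_finrank_frobPush hα e r _))

end Frobenius

/-! ### Vandermonde arguments -/

section Vandermonde

theorem eq_zero_of_forall_sum_mul_pow_eq_zero {L : Type*} [Field L] {ι : Type*} [Fintype ι]
    {u γ : ι → L} (hγ : Function.Injective γ) (h : ∀ k : ℕ, ∑ i, u i * γ i ^ k = 0) : u = 0 := by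
  have hli := (linearIndependent_monoidHom (Multiplicative ℕ) L).comp
    (fun i => powersHom L (γ i)) ((powersHom L).injective.comp hγ)
  rw [Fintype.linearIndependent_iff] at hli
  funext i
  refine hli u ?_ i
  funext k
  simpa using h k.toAdd

theorem exists_functional_of_notMem {L : Type*} [Field L] {ι : Type*} [Fintype ι]
    {W : Submodule L (ι → L)} {x : ι → L} (hx : x ∉ W) :
    ∃ u : ι → L, (∀ w ∈ W, ∑ i, u i * w i = 0) ∧ ∑ i, u i * x i ≠ 0 := by
  classical
  obtain ⟨f, hfx, hfW⟩ := Submodule.exists_le_ker_of_notMem hx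
  have hf : ∀ w, ∑ i, f (Pi.single i 1) * w i = f w := fun w => by
    rw [LinearMap.pi_apply_eq_sum_univ f w]
    exact Finset.sum_congr rfl fun i _ => by simp [mul_comm, single_one_eq_ite]
  exact ⟨fun i => f (Pi.single i 1), fun w hw => by rw [hf]; exact hfW hw, by rwa [hf]⟩

/-- A subspace that contains the orbit of a vector without zero coordinates under a diagonal
matrix with distinct entries is everything. -/
theorem eq_top_of_forall_mul_pow_mem {L : Type*} [Field L] {ι : Type*} [Fintype ι]
    {W : Submodule L (ι → L)} {w γ : ι → L} (hw : ∀ i, w i ≠ 0) (hγ : Function.Injective γ)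
    (h : ∀ k : ℕ, (fun i => w i * γ i ^ k) ∈ W) : W = ⊤ := by
  by_contra hW
  obtain ⟨x, hx⟩ : ∃ x, x ∉ W := by
    by_contra! hall
    exact hW (Submodule.eq_top_iff'.2 hall)
  obtain ⟨u, hu, hux⟩ := exists_functional_of_notMem hx
  have h0 : (fun i => u i * w i) = 0 := eq_zero_of_forall_sum_mul_pow_eq_zero hγ fun k => by
    rw [← hu _ (h k)]
    exact Finset.sum_congr rfl fun i _ => by ring
  apply hux
  refine Finset.sum_eq_zero fun i _ => ?_
  have := congr_fun h0 i
  simp only [Pi.zero_apply, mul_eq_zero, hw i, or_false] at this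
  rw [this, zero_mul]

end Vandermonde

/-! ### Degrees in a finitely generated field -/

section Degree

variable {L : Type*} [Field L] (p : ℕ) [Fact p.Prime] [Algebra (ZMod p) L] {σ : Type*} (g : σ → L)

/-- `x` is the value at `g` of a polynomial of total degree at most `D` over the prime field. -/
def HasDegreeLE (D : ℕ) (x : L) : Prop :=
  ∃ P : MvPolynomial σ (ZMod p), P.totalDegree ≤ D ∧ MvPolynomial.aeval g P = x

variable {p g}

theorem HasDegreeLE.mono {D D' : ℕ} {x : L} (h : HasDegreeLE p g D x) (hD : D ≤ D') :
    HasDegreeLE p g D' x := by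
  obtain ⟨P, hP, rfl⟩ := h
  exact ⟨P, hP.trans hD, rfl⟩

theorem HasDegreeLE.mul {D D' : ℕ} {x y : L} (h : HasDegreeLE p g D x)
    (h' : HasDegreeLE p g D' y) : HasDegreeLE p g (D + D') (x * y) := by
  obtain ⟨P, hP, rfl⟩ := h
  obtain ⟨Q, hQ, rfl⟩ := h'
  exact ⟨P * Q, (MvPolynomial.totalDegree_mul P Q).trans (add_le_add hP hQ), map_mul _ _ _⟩

theorem HasDegreeLE.pow {D : ℕ} {x : L} (h : HasDegreeLE p g D x) (n : ℕ) :
    HasDegreeLE p g (n * D) (x ^ n) := by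
  obtain ⟨P, hP, rfl⟩ := h
  exact ⟨P ^ n, (MvPolynomial.totalDegree_pow P n).trans (Nat.mul_le_mul_left n hP), map_pow _ _ _⟩

theorem hasDegreeLE_one_gen (i : σ) : HasDegreeLE p g 1 (g i) :=
  ⟨MvPolynomial.X i, by simp, by simp⟩

theorem HasDegreeLE.sum {κ : Type*} {D : ℕ} {s : Finset κ} {f : κ → L}
    (h : ∀ k ∈ s, HasDegreeLE p g D (f k)) : HasDegreeLE p g D (∑ k ∈ s, f k) := by
  have : ∀ k, ∃ P : MvPolynomial σ (ZMod p), k ∈ s → P.totalDegree ≤ D ∧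
      MvPolynomial.aeval g P = f k := fun k => by
    by_cases hk : k ∈ s
    · obtain ⟨P, hP⟩ := h k hk
      exact ⟨P, fun _ => hP⟩
    · exact ⟨0, fun h => absurd h hk⟩
  choose P hP using this
  refine ⟨∑ k ∈ s, P k, MvPolynomial.totalDegree_finsetSum_le fun k hk => (hP k hk).1, ?_⟩
  rw [map_sum]
  exact Finset.sum_congr rfl fun k hk => (hP k hk).2

theorem finite_setOf_hasDegreeLE [Finite σ] (D : ℕ) : {x : L | HasDegreeLE p g D x}.Finite := by
  have : Finite (MvPolynomial.restrictTotalDegree σ (ZMod p) D) :=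
    Module.finite_of_finite (ZMod p)
  refine (Set.finite_range fun P : MvPolynomial.restrictTotalDegree σ (ZMod p) D =>
    MvPolynomial.aeval g (P : MvPolynomial σ (ZMod p))).subset ?_
  rintro x ⟨P, hP, rfl⟩
  exact ⟨⟨P, (MvPolynomial.mem_restrictTotalDegree _ _ _).2 hP⟩, rfl⟩

theorem exists_common_denominator
    (hgen : ∀ x, ∃ r s : MvPolynomial σ (ZMod p),
      x = MvPolynomial.aeval g r / MvPolynomial.aeval g s)
    {X : Set L} (hX : X.Finite) :
    ∃ δ : L, δ ≠ 0 ∧ ∃ D, HasDegreeLE p g D δ ∧ ∀ x ∈ X, HasDegreeLE p g D (δ * x) := by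
  induction X, hX using Set.Finite.induction_on with
  | empty => exact ⟨1, one_ne_zero, 0, ⟨1, by simp, by simp⟩, by simp⟩
  | @insert x X _ _ ih =>
    obtain ⟨δ, hδ, D, hD, hDX⟩ := ih
    obtain ⟨r, s, rfl⟩ := hgen x
    by_cases hs : MvPolynomial.aeval g s = 0
    · refine ⟨δ, hδ, D, hD, ?_⟩
      rintro y (rfl | hy)
      · rw [hs, div_zero, mul_zero]
        exact ⟨0, by simp, by simp⟩
      · exact hDX y hy
    · have hs' : HasDegreeLE p g (max r.totalDegree s.totalDegree) (MvPolynomial.aeval g s) :=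
        ⟨s, le_max_right _ _, rfl⟩
      have hr' : HasDegreeLE p g (max r.totalDegree s.totalDegree) (MvPolynomial.aeval g r) :=
        ⟨r, le_max_left _ _, rfl⟩
      refine ⟨δ * MvPolynomial.aeval g s, mul_ne_zero hδ hs, _, hD.mul hs', ?_⟩
      rintro y (rfl | hy)
      · rw [mul_assoc, mul_div_cancel₀ _ hs]
        exact hD.mul hr'
      · rw [mul_right_comm]
        exact (hDX y hy).mul hs'

/-- A `p`-th-root-linear map divides degrees by `p`, up to a bounded contribution of the
monomials with all exponents below `p`. -/
theorem HasDegreeLE.apply_frobenius_coordinate [Finite σ] {c : L →+ L}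
    (hc : ∀ x y, c (y ^ p * x) = y * c x) {δ : L} {M : ℕ}
    (hδ : ∀ m : σ →₀ ℕ, (∀ i, m i < p) →
      HasDegreeLE p g M (δ * c (MvPolynomial.aeval g (MvPolynomial.monomial m (1 : ZMod p)))))
    {D : ℕ} {x : L} (hx : HasDegreeLE p g D x) : HasDegreeLE p g (D / p + M) (δ * c x) := by
  have := Fintype.ofFinite σ
  have hp : 0 < p := (Fact.out : p.Prime).pos
  obtain ⟨P, hP, rfl⟩ := hx
  rw [P.as_sum, map_sum, map_sum, Finset.mul_sum]
  refine HasDegreeLE.sum fun m hm => ?_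
  let m₁ : σ →₀ ℕ := m.mapRange (· / p) (by simp)
  let m₀ : σ →₀ ℕ := m.mapRange (· % p) (by simp)
  have hmm : m = p • m₁ + m₀ := by
    ext i
    exact (Nat.div_add_mod (m i) p).symm
  have hdeg : m₁.degree ≤ D / p := by
    rw [Nat.le_div_iff_mul_le hp, mul_comm]
    refine le_trans ?_ ((MvPolynomial.le_totalDegree hm).trans hP)
    change p * m₁.degree ≤ m.degree
    conv_rhs => rw [hmm]
    simp
  have hcoeff : MvPolynomial.monomial m (MvPolynomial.coeff m P) =
      (MvPolynomial.monomial m₁ (MvPolynomial.coeff m P)) ^ p *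
        MvPolynomial.monomial m₀ (1 : ZMod p) := by
    rw [MvPolynomial.monomial_pow, MvPolynomial.monomial_mul, ZMod.pow_card, mul_one, ← hmm]
  rw [hcoeff, map_mul, map_pow, hc, mul_left_comm]
  refine HasDegreeLE.mul ⟨_, ?_, rfl⟩ (hδ m₀ fun i => Nat.mod_lt _ hp)
  exact (MvPolynomial.totalDegree_monomial_le _ _).trans hdeg

/-- In a finitely generated field, finitely many elements lie in a finite set that is stable
under multiplication by `r`-th powers, `r < p`, followed by a coordinate over the `p`-th powers. -/
theorem exists_finite_stable_set [Finite σ] {ι : Type*} [Finite ι]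
    (hgen : ∀ x, ∃ r s : MvPolynomial σ (ZMod p),
      x = MvPolynomial.aeval g r / MvPolynomial.aeval g s)
    (α u : ι → L) (hα : ∀ i, α i ∈ Set.range g) (hu : ∀ i, u i ∈ Set.range g)
    {J : Type*} (c : J → L →+ L) (hc : ∀ j x y, c j (y ^ p * x) = y * c j x)
    (hfin : ∀ x, {j | c j x ≠ 0}.Finite) :
    ∃ Γ : Set L, Γ.Finite ∧ (∀ i, u i ∈ Γ) ∧
      ∀ j i, ∀ r < p, ∀ x ∈ Γ, c j (α i ^ r * x) ∈ Γ := by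
  have hp2 : 2 ≤ p := (Fact.out : p.Prime).two_le
  have hB : {m : σ →₀ ℕ | ∀ i, m i < p}.Finite := by
    refine Set.Finite.of_injOn (f := fun m : σ →₀ ℕ => (m : σ → ℕ))
      (t := {f | ∀ i, f i ∈ Set.Iio p}) ?_ DFunLike.coe_injective.injOn
      (Set.Finite.pi' fun _ => Set.finite_Iio p)
    exact fun m hm i => hm i
  let b : (σ →₀ ℕ) → L := fun m => MvPolynomial.aeval g (MvPolynomial.monomial m (1 : ZMod p))
  have hX : {x | ∃ m : σ →₀ ℕ, (∀ i, m i < p) ∧ ∃ j, c j (b m) ≠ 0 ∧ c j (b m) = x}.Finite := by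
    refine (hB.biUnion fun m _ => (hfin (b m)).image fun j => c j (b m)).subset ?_
    rintro x ⟨m, hm, j, hj, rfl⟩
    exact Set.mem_biUnion hm ⟨j, hj, rfl⟩
  obtain ⟨δ, hδ, M, hM, hMX⟩ := exists_common_denominator hgen hX
  have hcb : ∀ j (m : σ →₀ ℕ), (∀ i, m i < p) → HasDegreeLE p g M (δ * c j (b m)) := by
    intro j m hm
    by_cases h0 : c j (b m) = 0
    · rw [h0, mul_zero]
      exact ⟨0, by simp, by simp⟩
    · exact hMX _ ⟨m, hm, j, h0, rfl⟩
  -- `A` bounds the degree of `δ ^ (p - 2) * α i ^ r` and of `δ ^ 2 * u i`; with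
  -- `D = A + 2 * M` one has `(A + D) / p + M ≤ D`.
  set A : ℕ := p * M + p + 1 with hA
  have hx : ∀ x, x ∈ Set.range g → HasDegreeLE p g 1 x := by
    rintro _ ⟨i, rfl⟩
    exact hasDegreeLE_one_gen i
  refine ⟨{x | HasDegreeLE p g (A + 2 * M) (δ ^ 2 * x)}, ?_, fun i => ?_, ?_⟩
  · exact (finite_setOf_hasDegreeLE (p := p) (g := g) (A + 2 * M)).preimage
      (f := fun x => δ ^ 2 * x) (mul_right_injective₀ (pow_ne_zero 2 hδ)).injOn
  · refine ((hM.pow 2).mul (hx _ (hu i))).mono ?_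
    omega
  · intro j i r hr x hx'
    simp only [Set.mem_ofPred_eq] at hx' ⊢
    have h1 : HasDegreeLE p g (A + (A + 2 * M)) (δ ^ p * (α i ^ r * x)) := by
      have h2 : δ ^ p * (α i ^ r * x) = (δ ^ (p - 2) * α i ^ r) * (δ ^ 2 * x) := by
        conv_lhs => rw [← Nat.sub_add_cancel hp2, pow_add]
        ring
      rw [h2]
      refine HasDegreeLE.mul (((hM.pow (p - 2)).mul ((hx _ (hα i)).pow r)).mono ?_) hx'
      have : (p - 2) * M ≤ p * M := Nat.mul_le_mul_right _ (Nat.sub_le _ _)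
      omega
    have h3 := h1.apply_frobenius_coordinate (hc j) (hcb j)
    rw [hc, ← mul_assoc, ← sq] at h3
    refine h3.mono ?_
    have : (A + (A + 2 * M)) / p ≤ (A + (A + 2 * M)) / 2 := Nat.div_le_div_left hp2 two_pos
    omega

end Degree

/-! ### Finiteness of the set of subspaces -/

section Finiteness

variable {L : Type*} [Field L]

/-- The subspace of vectors annihilated by a set of linear forms. -/
def solutions {ι : Type*} [Fintype ι] (S : Set (ι → L)) : Submodule L (ι → L) where
  carrier := {x | ∀ u ∈ S, ∑ i, u i * x i = 0}
  add_mem' := by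
    intro x y hx hy u hu
    simp [mul_add, Finset.sum_add_distrib, hx u hu, hy u hu]
  zero_mem' := by simp
  smul_mem' := by
    intro a x hx u hu
    simp only [Pi.smul_apply, smul_eq_mul, mul_left_comm _ a, ← Finset.mul_sum]
    rw [hx u hu, mul_zero]

theorem mem_solutions {ι : Type*} [Fintype ι] {S : Set (ι → L)} {x : ι → L} :
    x ∈ solutions S ↔ ∀ u ∈ S, ∑ i, u i * x i = 0 := Iff.rfl

variable (p : ℕ) [Fact p.Prime] [CharP L p]

/-- Coordinates over the subfield of `p`-th powers, followed by extraction of `p`-th roots. -/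
theorem exists_frobenius_coordinates : ∃ (J : Set L) (c : J → L →+ L),
    (∀ j x y, c j (y ^ p * x) = y * c j x) ∧ (∀ x, (∀ j, c j x = 0) → x = 0) ∧
    ∀ x, {j | c j x ≠ 0}.Finite := by
  let e := (frobenius L p).rangeRestrictFieldEquiv
  let b := Module.Basis.ofVectorSpace (frobenius L p).fieldRange L
  have he : ∀ z, e.symm z = 0 ↔ z = 0 := fun z => map_eq_zero_iff e.symm e.symm.injective
  refine ⟨_, fun j => e.symm.toAddMonoidHom.comp (b.coord j).toAddMonoidHom, ?_, ?_, ?_⟩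
  · intro j x y
    have h : y ^ p * x = e y • x := rfl
    rw [h]
    simp
  · intro x hx
    refine b.forall_coord_eq_zero_iff.1 fun j => ?_
    exact (he _).1 (hx j)
  · intro x
    refine (b.repr x).support.finite_toSet.subset fun j hj => ?_
    simp only [Set.mem_ofPred_eq, Finset.mem_coe, Finsupp.mem_support_iff] at *
    intro h
    apply hj
    exact (he _).2 h

variable {p}

theorem frobPull_one_solutions {ι : Type*} [Fintype ι] {J : Type*} {c : J → L →+ L}
    (hc : ∀ j x y, c j (y ^ p * x) = y * c j x) (hsep : ∀ x, (∀ j, c j x = 0) → x = 0)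
    (α : ι → L) (r : ℕ) (S : Set (ι → L)) :
    frobPull p α 1 r (solutions S) =
      solutions {v | ∃ u ∈ S, ∃ j, v = fun i => c j (α i ^ r * u i)} := by
  have key : ∀ (j : J) (u x : ι → L), c j (∑ i, u i * (α i ^ r * x i ^ p)) =
      ∑ i, c j (α i ^ r * u i) * x i := fun j u x => by
    rw [map_sum]
    refine Finset.sum_congr rfl fun i _ => ?_
    rw [mul_comm _ (x i), ← hc]
    congr 1
    ring
  ext x
  simp only [mem_frobPull, mem_solutions, pow_one]
  constructor
  · rintro h _ ⟨u, hu, j, rfl⟩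
    rw [← key, h u hu, map_zero]
  · intro h u hu
    refine hsep _ fun j => ?_
    rw [key]
    exact h _ ⟨u, hu, j, rfl⟩

variable [Algebra (ZMod p) L] {σ : Type*} {g : σ → L}

/-- The hyperplane of a linear form over a finitely generated field belongs to a finite set of
subspaces stable under pulling back. -/
theorem exists_finite_stable_submodules [Finite σ] {ι : Type*} [Fintype ι]
    (hgen : ∀ x, ∃ r s : MvPolynomial σ (ZMod p),
      x = MvPolynomial.aeval g r / MvPolynomial.aeval g s)
    (α u : ι → L) (hα : ∀ i, α i ∈ Set.range g) (hu : ∀ i, u i ∈ Set.range g) :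
    ∃ 𝒮 : Set (Submodule L (ι → L)), 𝒮.Finite ∧ solutions {u} ∈ 𝒮 ∧
      ∀ V ∈ 𝒮, ∀ r < p, frobPull p α 1 r V ∈ 𝒮 := by
  obtain ⟨J, c, hc, hsep, hfin⟩ := exists_frobenius_coordinates (L := L) p
  obtain ⟨Γ, hΓ, huΓ, hst⟩ := exists_finite_stable_set hgen α u hα hu c hc hfin
  refine ⟨solutions '' (Set.powerset {v : ι → L | ∀ i, v i ∈ Γ}), ?_, ?_, ?_⟩
  · exact (Set.Finite.pi' fun _ => hΓ).powerset.image _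
  · exact ⟨{u}, by simpa using huΓ, rfl⟩
  · rintro _ ⟨S, hS, rfl⟩ r hr
    rw [frobPull_one_solutions hc hsep]
    refine ⟨_, ?_, rfl⟩
    rintro _ ⟨w, hw, j, rfl⟩ i
    exact hst j i r hr _ (hS hw i)

end Finiteness

/-! ### Exponents of a subspace -/

section Zeros

variable {L : Type*} [Field L] {ι : Type*} (α : ι → L)

/-- The integers `n` with `α ^ n ∈ V` (coordinatewise). -/
def zeros (V : Submodule L (ι → L)) : Set ℤ := {n | (fun i => α i ^ n) ∈ V}

variable {α}

theorem mem_zeros {V : Submodule L (ι → L)} {n : ℤ} :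
    n ∈ zeros α V ↔ (fun i => α i ^ n) ∈ V := Iff.rfl

variable {p : ℕ} [Fact p.Prime] [CharP L p]

theorem mem_zeros_frobPull (hα : ∀ i, α i ≠ 0) {e r : ℕ} {V : Submodule L (ι → L)} {n : ℤ} :
    n ∈ zeros α (frobPull p α e r V) ↔ (r + p ^ e * n : ℤ) ∈ zeros α V := by
  rw [mem_zeros, mem_frobPull, mem_zeros]
  have : (fun i => α i ^ r * (α i ^ n) ^ p ^ e) = fun i => α i ^ (r + p ^ e * n : ℤ) := by
    funext i
    rw [zpow_add₀ (hα i), zpow_natCast, mul_comm (p ^ e : ℤ), zpow_mul]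
    norm_cast
  rw [this]

theorem zeros_nonempty_finrank_pos [Fintype ι] [Nonempty ι] (hα : ∀ i, α i ≠ 0)
    {V : Submodule L (ι → L)} {n : ℤ} (hn : n ∈ zeros α V) : 0 < Module.finrank L V := by
  rw [Module.finrank_pos_iff_exists_ne_zero]
  refine ⟨⟨_, hn⟩, fun h => ?_⟩
  have := congr_fun (congr_arg Subtype.val h) (Classical.arbitrary ι)
  exact zpow_ne_zero n (hα _) this

end Zeros

/-! ### Periodic subspaces -/

section Periodic

variable {L : Type*} [Field L] {p : ℕ} [Fact p.Prime] [CharP L p] {ι : Type*} {α : ι → L}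

variable (p α) in
/-- `V` is its own pullback along some block of `E` digits. -/
def IsPeriodic (E : ℕ) (V : Submodule L (ι → L)) : Prop :=
  ∃ r < p ^ E, frobPull p α E r V = V

theorem frobPull_mem {𝒮 : Set (Submodule L (ι → L))}
    (h : ∀ V ∈ 𝒮, ∀ r < p, frobPull p α 1 r V ∈ 𝒮) {V : Submodule L (ι → L)} (hV : V ∈ 𝒮)
    (e n : ℕ) : frobPull p α e (n % p ^ e) V ∈ 𝒮 := by
  induction e with
  | zero => rwa [pow_zero, Nat.mod_one, frobPull_zero_zero]
  | succ e ih =>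
    rw [pow_succ, Nat.mod_mul, ← frobPull_frobPull]
    exact h _ ih _ (Nat.mod_lt _ (Fact.out : p.Prime).pos)

theorem IsPeriodic.of_dvd {e E : ℕ} {V : Submodule L (ι → L)} (h : IsPeriodic p α e V)
    (hE : e ∣ E) : IsPeriodic p α E V := by
  obtain ⟨k, rfl⟩ := hE
  obtain ⟨r, hr, hV⟩ := h
  have hp : 0 < p := (Fact.out : p.Prime).pos
  induction k with
  | zero => exact ⟨0, by simp, frobPull_zero_zero V⟩
  | succ k ih =>
    obtain ⟨s, hs, hsV⟩ := ih
    refine ⟨s + p ^ (e * k) * r, ?_, ?_⟩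
    · rw [mul_add, mul_one, pow_add]
      calc s + p ^ (e * k) * r < p ^ (e * k) * (r + 1) := by rw [mul_add, mul_one]; omega
        _ ≤ _ := Nat.mul_le_mul_left _ hr
    · rw [mul_add, mul_one, ← frobPull_frobPull, hsV, hV]

/-- Reading boundedly many digits always leads to a subspace that is periodic, with a period
independent of the digits: this is the pigeonhole principle. -/
theorem exists_isPeriodic {𝒮 : Set (Submodule L (ι → L))} (hfin : 𝒮.Finite)
    (h : ∀ V ∈ 𝒮, ∀ r < p, frobPull p α 1 r V ∈ 𝒮) :
    ∃ N E : ℕ, 1 ≤ E ∧ ∀ V ∈ 𝒮, ∀ n : ℕ, ∃ i ≤ N,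
      IsPeriodic p α E (frobPull p α i (n % p ^ i) V) := by
  have := hfin.fintype
  refine ⟨Fintype.card 𝒮, (Fintype.card 𝒮).factorial, Nat.factorial_pos _, fun V hV n => ?_⟩
  let f : Fin (Fintype.card 𝒮 + 1) → 𝒮 := fun i => ⟨_, frobPull_mem h hV i n⟩
  obtain ⟨i, j, hij, hf⟩ : ∃ i j, i < j ∧ f i = f j := by
    obtain ⟨i, j, hij, hf⟩ := Fintype.exists_ne_map_eq_of_card_lt f (by simp)
    rcases lt_or_gt_of_ne hij with h | h
    · exact ⟨i, j, h, hf⟩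
    · exact ⟨j, i, h, hf.symm⟩
  have hij' : (i : ℕ) < j := hij
  have hf' : frobPull p α i (n % p ^ (i : ℕ)) V = frobPull p α j (n % p ^ (j : ℕ)) V :=
    congr_arg Subtype.val hf
  have hj := j.2
  refine ⟨i, by omega, IsPeriodic.of_dvd (e := j - i) ?_ (Nat.dvd_factorial (by omega) (by omega))⟩
  refine ⟨n / p ^ (i : ℕ) % p ^ ((j : ℕ) - i),
    Nat.mod_lt _ (pow_pos (Fact.out : p.Prime).pos _), ?_⟩
  rw [frobPull_frobPull, ← Nat.mod_mul, ← pow_add, Nat.add_sub_cancel' hij'.le, ← hf']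

theorem eq_top_of_frobPush_eq_frobPush [Fintype ι] (hα : ∀ i, α i ≠ 0)
    (hαα : ∀ n : ℕ, 0 < n → Function.Injective fun i => α i ^ n) {e A B : ℕ} (hAB : A < B)
    {W Y : Submodule L (ι → L)} (hA : frobPush p α e A Y = W) (hB : frobPush p α e B Y = W)
    {m : ℤ} (hm : m ∈ zeros α W) : W = ⊤ := by
  -- multiplication by `α ^ (B - A)` maps `W` into itself
  have hstab : ∀ w ∈ W, (fun i => w i * α i ^ (B - A)) ∈ W := by
    have h1 : W ≤ frobPull p α 0 (B - A) W := by
      rw [← frobPush_le_iff]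
      conv_lhs => rw [← hA]
      rw [frobPush_frobPush, zero_add, pow_zero, one_mul, Nat.sub_add_cancel hAB.le, hB]
    intro w hw
    have := mem_frobPull.1 (h1 hw)
    simpa [mul_comm] using this
  refine eq_top_of_forall_mul_pow_mem (fun i => zpow_ne_zero m (hα i))
    (hαα (B - A) (by omega)) fun k => ?_
  induction k with
  | zero => simpa using mem_zeros.1 hm
  | succ k ih =>
    have := hstab _ ih
    simpa only [pow_succ, mul_assoc] using this

/-- Leaving a period lowers the dimension: two different ways of returning to a periodic subspace
of the same dimension would give a power of `α` that stabilizes `W`. -/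
theorem finrank_lt_of_isPeriodic [Fintype ι] (hα : ∀ i, α i ≠ 0)
    (hαα : ∀ n : ℕ, 0 < n → Function.Injective fun i => α i ^ n) {E f S r : ℕ} (hEf : E ≤ f)
    {W : Submodule L (ι → L)} (hr : r < p ^ E) (hW : frobPull p α E r W = W)
    (hS : S % p ^ E ≠ r) (hU : IsPeriodic p α E (frobPull p α f S W))
    {m : ℤ} (hm : m ∈ zeros α W) (hWtop : W ≠ ⊤) :
    Module.finrank L (frobPull p α f S W) < Module.finrank L W := by
  by_contra! hle
  obtain ⟨t, -, ht⟩ := hU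
  have h1 : frobPush p α f S (frobPull p α f S W) = W := frobPush_frobPull_eq hα hle
  have h2 : frobPush p α E r W = W := by
    have := frobPush_frobPull_eq (p := p) (e := E) (r := r) (V := W) hα (by rw [hW])
    rwa [hW] at this
  set U := frobPull p α f S W with hUdef
  have h3 : frobPush p α E t U = U := by
    have := frobPush_frobPull_eq (p := p) (e := E) (r := t) (V := U) hα (by rw [ht])
    rwa [ht] at this
  have hA : frobPush p α (f + E) (S + p ^ f * t) U = W := by
    rw [← frobPush_frobPush, h3, h1]
  have hB : frobPush p α (f + E) (r + p ^ E * S) U = W := by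
    rw [add_comm f E, ← frobPush_frobPush, h1, h2]
  have hne : S + p ^ f * t ≠ r + p ^ E * S := by
    intro h
    apply hS
    have h4 := congr_arg (· % p ^ E) h
    obtain ⟨k, rfl⟩ := Nat.exists_eq_add_of_le hEf
    simpa [pow_add, mul_assoc, Nat.mod_eq_of_lt hr] using h4
  rcases lt_or_gt_of_ne hne with h | h
  · exact hWtop (eq_top_of_frobPush_eq_frobPush hα hαα h hA hB hm)
  · exact hWtop (eq_top_of_frobPush_eq_frobPush hα hαα h hB hA hm)

end Periodic

/-! ### Removing the ordering of the exponents -/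

section Closure

/-- Over a perfect field, a linear relation that holds for the vectors `C ^ (q ^ m)` with `m`
large holds for all `m`: the spans of the tails of this sequence stabilize, and extracting
`q`-th roots shows that they are all equal. -/
theorem sum_mul_pow_eq_zero_of_eventually {Ω : Type*} [Field Ω] {p : ℕ} [Fact p.Prime]
    [CharP Ω p] [PerfectRing Ω p] {ι : Type*} [Fintype ι] (E : ℕ) (w C : ι → Ω) (k : ℕ)
    (h : ∀ m, k ≤ m → ∑ i, w i * C i ^ (p ^ E) ^ m = 0) (m : ℕ) :
    ∑ i, w i * C i ^ (p ^ E) ^ m = 0 := by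
  let x : ℕ → ι → Ω := fun m i => C i ^ (p ^ E) ^ m
  let U : ℕ → Submodule Ω (ι → Ω) := fun k => Submodule.span Ω (x '' Set.Ici k)
  have hxU : ∀ {k m}, k ≤ m → x m ∈ U k := fun hkm => Submodule.subset_span ⟨_, hkm, rfl⟩
  have hU : Antitone U := fun a b hab =>
    Submodule.span_mono (Set.image_mono (Set.Ici_subset_Ici.2 hab))
  let φ := (iterateFrobeniusEquiv Ω p E).symm
  have hφ : ∀ a, φ (a ^ p ^ E) = a := fun a => by
    rw [RingEquiv.symm_apply_eq, iterateFrobeniusEquiv_def]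
  have hφU : ∀ m, ∀ z ∈ U (m + 1), (fun i => φ (z i)) ∈ U m := by
    intro m z hz
    induction hz using Submodule.span_induction with
    | mem z hz =>
      obtain ⟨l, hl, rfl⟩ := hz
      have hl' : m + 1 ≤ l := hl
      obtain ⟨l, rfl⟩ := Nat.exists_eq_add_of_le' (le_trans (Nat.le_add_left 1 m) hl')
      convert hxU (k := m) (m := l) (by omega) using 1
      funext i
      simp only [x, pow_succ, pow_mul, hφ]
    | zero =>
      convert (U m).zero_mem using 1
      funext i
      simp
    | add y z _ _ hy hz =>
      convert (U m).add_mem hy hz using 1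
      funext i
      simp
    | smul a z _ hz =>
      convert (U m).smul_mem (φ a) hz using 1
      funext i
      simp
  have hdesc : ∀ m, x (m + 1) ∈ U (m + 2) → x m ∈ U (m + 1) := by
    intro m hm
    convert hφU (m + 1) _ hm using 1
    funext i
    simp only [x, pow_succ, pow_mul, hφ]
  obtain ⟨n, hn⟩ := IsArtinian.monotone_stabilizes (R := Ω) (M := ι → Ω)
    ⟨fun k => OrderDual.toDual (U k), fun a b hab => hU hab⟩
  have hn' : ∀ m, n ≤ m → U n = U m := hn
  have hstep : ∀ m, x m ∈ U (m + 1) := by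
    have key : ∀ j m, n ≤ m + j → x m ∈ U (m + 1) := by
      intro j
      induction j with
      | zero =>
        intro m hm
        rw [← hn' (m + 1) (by omega), hn' m (by omega)]
        exact hxU le_rfl
      | succ j ih => exact fun m hm => hdesc m (ih (m + 1) (by omega))
    exact fun m => key n m (by omega)
  have hle : ∀ m, U m ≤ U (m + 1) := fun m => by
    refine Submodule.span_le.2 ?_
    rintro _ ⟨l, hl, rfl⟩
    rcases eq_or_lt_of_le (show m ≤ l from hl) with rfl | h
    · exact hstep m
    · exact hxU h
  have hmem : x m ∈ U k := monotone_nat_of_le_succ hle (Nat.zero_le k) (hxU (Nat.zero_le m))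
  have hker : U k ≤ solutions {w} := by
    refine Submodule.span_le.2 ?_
    rintro _ ⟨l, hl, rfl⟩
    simpa [mem_solutions] using h l hl
  simpa [mem_solutions] using hker hmem

theorem dvd_add_sum_iff {q : ℤ} {j : ℕ} (b₀ : ℤ) (b : Fin j → ℤ) (l : Fin j → ℕ) :
    q - 1 ∣ b₀ + ∑ i, b i * q ^ l i ↔ q - 1 ∣ b₀ + ∑ i, b i := by
  refine dvd_iff_dvd_of_dvd_sub ?_
  rw [add_sub_add_left_eq_sub, ← Finset.sum_sub_distrib]
  refine Finset.dvd_sum fun i _ => ?_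
  rw [← mul_sub_one]
  exact (sub_one_dvd_pow_sub_one q (l i)).mul_left _

/-- If all `n` with `(q - 1) n = b₀ + ∑ bᵢ q ^ lᵢ` and `l` large satisfy `α ^ n ∈ W`, then the
same holds for all `l`. -/
theorem mem_zeros_of_eventually {L : Type*} [Field L] {p : ℕ} [Fact p.Prime] [CharP L p]
    {ι : Type*} [Fintype ι] {α : ι → L} (hα : ∀ i, α i ≠ 0) {E : ℕ} (hE : 1 ≤ E)
    {W : Submodule L (ι → L)} {j : ℕ} (b₀ : ℤ) (b : Fin j → ℤ) (k : ℕ)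
    (h : ∀ l : Fin j → ℕ, (∀ i, k ≤ l i) → ∀ n : ℤ,
      ((p : ℤ) ^ E - 1) * n = b₀ + ∑ i, b i * ((p : ℤ) ^ E) ^ l i → n ∈ zeros α W)
    (l : Fin j → ℕ) (n : ℤ)
    (hn : ((p : ℤ) ^ E - 1) * n = b₀ + ∑ i, b i * ((p : ℤ) ^ E) ^ l i) : n ∈ zeros α W := by
  classical
  by_contra hnW
  obtain ⟨u, hu, hux⟩ := exists_functional_of_notMem hnW
  apply hux
  have hq : 1 < p ^ E := Nat.one_lt_pow (by omega) (Fact.out : p.Prime).one_lt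
  -- `β` is a vector of `(q - 1)`-th roots of the `α i`
  have hβ : ∀ i, ∃ z : AlgebraicClosure L, z ^ (p ^ E - 1) = algebraMap L _ (α i) := fun i =>
    IsAlgClosed.exists_pow_nat_eq _ (by omega)
  choose β hβ using hβ
  have hα' : ∀ i, algebraMap L (AlgebraicClosure L) (α i) ≠ 0 := fun i => by simpa using hα i
  have hβ0 : ∀ i, β i ≠ 0 := fun i h0 => by
    have h1 := hβ i
    rw [h0, zero_pow (by omega)] at h1
    exact hα' i h1.symm
  have hβn : ∀ i (n : ℤ), β i ^ (((p : ℤ) ^ E - 1) * n) = algebraMap L _ (α i ^ n) := fun i n => by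
    have h1 : ((p : ℤ) ^ E - 1) = ((p ^ E - 1 : ℕ) : ℤ) := by
      rw [Nat.cast_sub hq.le]
      simp
    rw [h1, zpow_mul, zpow_natCast, hβ, map_zpow₀]
  let u' : ι → AlgebraicClosure L := fun i => algebraMap L _ (u i)
  have hrel : ∀ n : ℤ, ∑ i, u' i * β i ^ (((p : ℤ) ^ E - 1) * n) =
      algebraMap L _ (∑ i, u i * α i ^ n) := fun n => by
    simp only [hβn, map_sum, map_mul, u']
  have main : ∀ s : Finset (Fin j), ∀ l : Fin j → ℕ, (∀ i ∉ s, k ≤ l i) →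
      ∑ i, u' i * β i ^ (b₀ + ∑ a, b a * ((p : ℤ) ^ E) ^ l a) = 0 := by
    intro s
    -- the exponents in `s` are freed one at a time
    induction s using Finset.induction_on with
    | empty =>
      intro l hl
      have hdvd : ((p : ℤ) ^ E - 1) ∣ b₀ + ∑ a, b a * ((p : ℤ) ^ E) ^ l a := by
        rw [dvd_add_sum_iff, ← dvd_add_sum_iff, ← hn]
        exact dvd_mul_right _ _
      obtain ⟨n', hn'⟩ := hdvd
      rw [hn', hrel, hu _ (h l (fun i => hl i (by simp)) n' hn'.symm), map_zero]
    | insert a s ha ih =>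
      intro l hl
      have hexp : ∀ m, ∑ i, u' i * β i ^ (b₀ + ∑ c, b c * ((p : ℤ) ^ E) ^
            (Function.update l a m c)) =
          ∑ i, (u' i * β i ^ (b₀ + ∑ c ∈ Finset.univ.erase a, b c * ((p : ℤ) ^ E) ^ l c)) *
            (β i ^ b a) ^ (p ^ E) ^ m := fun m => by
        refine Finset.sum_congr rfl fun i _ => ?_
        rw [mul_assoc, ← zpow_natCast (β i ^ b a), ← zpow_mul, ← zpow_add₀ (hβ0 i),
          ← Finset.sum_erase_add _ _ (Finset.mem_univ a), add_assoc, Function.update_self]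
        congr 4
        refine Finset.sum_congr rfl fun c hc => ?_
        rw [Function.update_of_ne (Finset.ne_of_mem_erase hc)]
      have h1 := sum_mul_pow_eq_zero_of_eventually (p := p) E
        (fun i => u' i * β i ^ (b₀ + ∑ c ∈ Finset.univ.erase a, b c * ((p : ℤ) ^ E) ^ l c))
        (fun i => β i ^ b a) k (fun m hm => by
          rw [← hexp]
          refine ih _ fun i hi => ?_
          by_cases hia : i = a
          · rwa [hia, Function.update_self]
          · rw [Function.update_of_ne hia]
            exact hl i (by simp [hia, hi])) (l a)
      rwa [← hexp, Function.update_eq_self] at h1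
  have := main Finset.univ l (by simp)
  rw [← hn, hrel] at this
  exact (map_eq_zero _).1 this

end Closure

/-! ### Covering by patterns -/

section Patterns

/-- The integers `n` with `(q - 1) n = b₀ + ∑ bᵢ q ^ kᵢ` for some exponents `kᵢ ∈ ℕ`. -/
def patternSet (q : ℤ) {j : ℕ} (b₀ : ℤ) (b : Fin j → ℤ) : Set ℤ :=
  {n | ∃ k : Fin j → ℕ, (q - 1) * n = b₀ + ∑ i, b i * q ^ k i}

/-- The natural numbers in `Z` are covered by finitely many pattern sets contained in `Z`, each
with fewer than `D` exponents. -/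
def CoveredByPatterns (q : ℤ) (D : ℕ) (Z : Set ℤ) : Prop :=
  ∃ 𝒬 : Set (Σ j, ℤ × (Fin j → ℤ)), 𝒬.Finite ∧
    (∀ P ∈ 𝒬, P.1 < D ∧ patternSet q P.2.1 P.2.2 ⊆ Z) ∧
    ∀ n : ℕ, (n : ℤ) ∈ Z → ∃ P ∈ 𝒬, (n : ℤ) ∈ patternSet q P.2.1 P.2.2

theorem mem_patternSet_cons {q b₀ B n : ℤ} {j : ℕ} {b : Fin j → ℤ} :
    n ∈ patternSet q b₀ (Fin.cons B b : Fin (j + 1) → ℤ) ↔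
      ∃ (k : ℕ) (l : Fin j → ℕ), (q - 1) * n = b₀ + (B * q ^ k + ∑ i, b i * q ^ l i) := by
  constructor
  · rintro ⟨k, hk⟩
    exact ⟨k 0, fun i => k i.succ, by simpa [Fin.sum_univ_succ] using hk⟩
  · rintro ⟨k, l, h⟩
    exact ⟨Fin.cons k l, by simpa [Fin.sum_univ_succ] using h⟩

variable {L : Type*} [Field L] {p : ℕ} [Fact p.Prime] [CharP L p] {ι : Type*} {α : ι → L}

/-- Prefixing `m` with `k` copies of the period of `W`. -/
theorem exists_iterate_mem_zeros (hα : ∀ i, α i ≠ 0) {E r : ℕ} {W : Submodule L (ι → L)}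
    (hW : frobPull p α E r W = W) {m : ℤ} (hm : m ∈ zeros α W) (k : ℕ) :
    ∃ n ∈ zeros α W, ((p : ℤ) ^ E - 1) * n =
      -r + ((p : ℤ) ^ E) ^ k * (r + ((p : ℤ) ^ E - 1) * m) := by
  induction k with
  | zero => exact ⟨m, hm, by ring⟩
  | succ k ih =>
    obtain ⟨n, hn, h⟩ := ih
    refine ⟨r + p ^ E * n, (mem_zeros_frobPull hα).1 (by rwa [hW]), ?_⟩
    linear_combination (p : ℤ) ^ E * h

theorem isCoprime_pow_sub_one_pow (p : ℤ) {E : ℕ} (hE : 1 ≤ E) (f : ℕ) :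
    IsCoprime (p ^ E - 1) (p ^ f) := by
  refine IsCoprime.pow_right ⟨-1, p ^ (E - 1), ?_⟩
  rw [← pow_succ, Nat.sub_add_cancel hE]
  ring

/-- Repeating the period of `W` an arbitrary number of times before leaving it through the digits
`S` adds one exponent to a pattern. -/
theorem patternSet_cons_subset_zeros [Fintype ι] (hα : ∀ i, α i ≠ 0) {E r f S : ℕ} (hE : 1 ≤ E)
    {W : Submodule L (ι → L)} (hW : frobPull p α E r W = W) {j : ℕ} {b₀ : ℤ} {b : Fin j → ℤ}
    (h : patternSet ((p : ℤ) ^ E) b₀ b ⊆ zeros α (frobPull p α f S W)) :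
    patternSet ((p : ℤ) ^ E) (-r)
      (Fin.cons (r + ((p : ℤ) ^ E - 1) * S + p ^ f * b₀) (fun i => p ^ f * b i) :
        Fin (j + 1) → ℤ) ⊆ zeros α W := by
  intro n hn
  obtain ⟨k, l, hkl⟩ := mem_patternSet_cons.1 hn
  rw [← add_assoc] at hkl
  refine mem_zeros_of_eventually hα hE _ _ k ?_ l n hkl
  clear hkl hn n l
  intro l hl n hn
  have hq : (1 : ℤ) < (p : ℤ) ^ E := by
    exact_mod_cast Nat.one_lt_pow (by omega) (Fact.out : p.Prime).one_lt
  set q : ℤ := (p : ℤ) ^ E with hqdef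
  have hsum : ∑ i, (p : ℤ) ^ f * b i * q ^ l i = p ^ f * q ^ k * ∑ i, b i * q ^ (l i - k) := by
    rw [Finset.mul_sum]
    refine Finset.sum_congr rfl fun i _ => ?_
    conv_lhs => rw [← Nat.add_sub_cancel' (hl i), pow_add]
    ring
  rw [hsum] at hn
  have hdvd : q - 1 ∣ b₀ + ∑ i, b i * q ^ (l i - k) := by
    have hcop : IsCoprime (q - 1) ((p : ℤ) ^ f * q ^ k) := by
      exact (isCoprime_pow_sub_one_pow p hE f).mul_right
        (isCoprime_pow_sub_one_pow p hE E).pow_right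
    refine hcop.dvd_of_dvd_mul_left ?_
    have h2 : (p : ℤ) ^ f * q ^ k * (b₀ + ∑ i, b i * q ^ (l i - k)) =
        (q - 1) * (n - S * q ^ k) - r * (q ^ k - 1) := by
      linear_combination -hn
    rw [h2]
    exact dvd_sub (dvd_mul_right _ _) ((sub_one_dvd_pow_sub_one q k).mul_left _)
  obtain ⟨n', hn'⟩ := hdvd
  have hm : (S + p ^ f * n' : ℤ) ∈ zeros α W := (mem_zeros_frobPull hα).1 (h ⟨_, hn'.symm⟩)
  obtain ⟨n'', hn''W, hn''⟩ := exists_iterate_mem_zeros hα hW hm k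
  have : n = n'' := by
    refine mul_left_cancel₀ (sub_ne_zero.2 hq.ne') ?_
    rw [← hqdef] at hn''
    linear_combination hn - hn'' + (p : ℤ) ^ f * q ^ k * hn'
  rwa [this]

/-- Induction on the dimension: an element of `zeros α W` follows the period of `W` for a while and
then leaves it towards a periodic subspace of smaller dimension. Only `0` may follow the period
forever. -/
theorem coveredByPatterns_of_isPeriodic [Fintype ι] [Nonempty ι] (hα : ∀ i, α i ≠ 0)
    (hαα : ∀ n : ℕ, 0 < n → Function.Injective fun i => α i ^ n)
    {𝒮 : Set (Submodule L (ι → L))} (hclosed : ∀ V ∈ 𝒮, ∀ r < p, frobPull p α 1 r V ∈ 𝒮)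
    {N E : ℕ} (hE : 1 ≤ E) (hper : ∀ V ∈ 𝒮, ∀ n : ℕ, ∃ i ≤ N,
      IsPeriodic p α E (frobPull p α i (n % p ^ i) V))
    {W : Submodule L (ι → L)} (hWS : W ∈ 𝒮) (hWper : IsPeriodic p α E W) (hWtop : W ≠ ⊤) :
    CoveredByPatterns ((p : ℤ) ^ E) (Module.finrank L W) (zeros α W) := by
  induction hD : Module.finrank L W using Nat.strong_induction_on generalizing W with
  | _ D ih =>
  subst hD
  obtain ⟨r, hr, hWr⟩ := hWper
  have hq : 1 < p ^ E := Nat.one_lt_pow (by omega) (Fact.out : p.Prime).one_lt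
  -- the ways to leave the period of `W`
  let s : Set (ℕ × ℕ) := {x | x.1 < E + N + 1 ∧ x.2 < p ^ (E + N) ∧
    frobPull p α x.1 x.2 W ∈ 𝒮 ∧ IsPeriodic p α E (frobPull p α x.1 x.2 W) ∧
    Module.finrank L (frobPull p α x.1 x.2 W) < Module.finrank L W}
  have hs : s.Finite := ((Set.finite_Iio (E + N + 1)).prod (Set.finite_Iio (p ^ (E + N)))).subset
    fun x hx => ⟨hx.1, hx.2.1⟩
  let F : ℕ × ℕ → (Σ j, ℤ × (Fin j → ℤ)) → Σ j, ℤ × (Fin j → ℤ) := fun x P =>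
    ⟨P.1 + 1, -r, Fin.cons (r + ((p : ℤ) ^ E - 1) * x.2 + p ^ x.1 * P.2.1)
      (fun i => p ^ x.1 * P.2.2 i)⟩
  have hcov : ∀ x ∈ s, CoveredByPatterns ((p : ℤ) ^ E)
      (Module.finrank L (frobPull p α x.1 x.2 W)) (zeros α (frobPull p α x.1 x.2 W)) := by
    rintro x ⟨-, -, hx1, hx2, hx3⟩
    refine ih _ hx3 hx1 hx2 (fun htop => ?_) rfl
    rw [htop, finrank_top] at hx3
    exact absurd (Submodule.finrank_le W) (not_le.2 hx3)
  have hexit : ∀ n : ℕ, (n : ℤ) ∈ zeros α W → n % p ^ E ≠ r →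
      ∃ x ∈ s, ∃ m : ℕ, (m : ℤ) ∈ zeros α (frobPull p α x.1 x.2 W) ∧ n = x.2 + p ^ x.1 * m := by
    intro n hn hnr
    obtain ⟨i, hi, hU⟩ := hper _ (frobPull_mem hclosed hWS E n) (n / p ^ E)
    rw [frobPull_frobPull, ← Nat.mod_mul, ← pow_add] at hU
    refine ⟨(E + i, n % p ^ (E + i)), ⟨by simp; omega, ?_, frobPull_mem hclosed hWS _ _, hU, ?_⟩,
      n / p ^ (E + i), ?_, (Nat.mod_add_div _ _).symm⟩
    · exact (Nat.mod_lt _ (pow_pos (Fact.out : p.Prime).pos _)).trans_le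
        (Nat.pow_le_pow_right (Fact.out : p.Prime).pos (by omega))
    · refine finrank_lt_of_isPeriodic hα hαα (Nat.le_add_right E i) hr hWr ?_ hU hn hWtop
      rwa [Nat.mod_mod_of_dvd _ (pow_dvd_pow p (Nat.le_add_right E i))]
    · rw [mem_zeros_frobPull hα]
      have : ((n % p ^ (E + i) : ℕ) : ℤ) + (p : ℤ) ^ (E + i) * ((n / p ^ (E + i) : ℕ) : ℤ) = n := by
        exact_mod_cast Nat.mod_add_div _ _
      rwa [this]
  -- every other element of `zeros α W` arises from such an exit by repeating the period
  have hzero : ∀ n : ℕ, (n : ℤ) ∈ zeros α W → (r = 0 ∧ n = 0) ∨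
      ∃ x ∈ s, ∃ m : ℕ, (m : ℤ) ∈ zeros α (frobPull p α x.1 x.2 W) ∧
      ∃ k : ℕ, ((p : ℤ) ^ E - 1) * n =
        -r + ((p : ℤ) ^ E) ^ k * (r + ((p : ℤ) ^ E - 1) * (x.2 + p ^ x.1 * m)) := by
    intro n
    induction n using Nat.strong_induction_on with
    | _ n ihn =>
    intro hn
    by_cases hnr : n % p ^ E = r
    · rcases Nat.eq_zero_or_pos n with rfl | hpos
      · left
        simpa using hnr.symm
      · right
        have hdecomp : n = r + p ^ E * (n / p ^ E) := by
          conv_lhs => rw [← Nat.mod_add_div n (p ^ E), hnr]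
        have hdecomp' : (n : ℤ) = r + (p : ℤ) ^ E * ((n / p ^ E : ℕ) : ℤ) := by
          exact_mod_cast hdecomp
        have hn' : ((n / p ^ E : ℕ) : ℤ) ∈ zeros α W := by
          rw [← hWr, mem_zeros_frobPull hα, ← hdecomp']
          exact hn
        rcases ihn _ (Nat.div_lt_self hpos hq) hn' with ⟨hr0, hn0⟩ | ⟨x, hx, m, hm, k, hk⟩
        · rw [hr0, hn0] at hdecomp
          omega
        · refine ⟨x, hx, m, hm, k + 1, ?_⟩
          rw [hdecomp']
          linear_combination (p : ℤ) ^ E * hk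
    · right
      obtain ⟨x, hx, m, hm, hnm⟩ := hexit n hn hnr
      refine ⟨x, hx, m, hm, 0, ?_⟩
      rw [hnm]
      push_cast
      ring
  choose! 𝒬 hQfin hsub hcov using hcov
  refine ⟨{P | P = ⟨0, 0, Fin.elim0⟩ ∧ (0 : ℤ) ∈ zeros α W} ∪ ⋃ x ∈ s, F x '' 𝒬 x, ?_, ?_, ?_⟩
  · refine Set.Finite.union ?_ (hs.biUnion fun x hx => (hQfin x hx).image _)
    exact (Set.finite_singleton _).subset fun P hP => hP.1
  · rintro P (⟨rfl, h0⟩ | hP)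
    · refine ⟨zeros_nonempty_finrank_pos hα h0, ?_⟩
      rintro n ⟨k, hk⟩
      have hq' : (p : ℤ) ^ E - 1 ≠ 0 := sub_ne_zero.2 (by exact_mod_cast hq.ne')
      have hn : n = 0 := by simpa [hq'] using hk
      rwa [hn]
    · simp only [Set.mem_iUnion] at hP
      obtain ⟨x, hx, P, hP, rfl⟩ := hP
      obtain ⟨hlt, hP⟩ := hsub x hx P hP
      exact ⟨(Nat.succ_le_of_lt hlt).trans_lt hx.2.2.2.2,
        patternSet_cons_subset_zeros hα hE hWr hP⟩
  · intro n hn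
    rcases hzero n hn with ⟨-, rfl⟩ | ⟨x, hx, m, hm, k, hk⟩
    · exact ⟨_, Or.inl ⟨rfl, hn⟩, Fin.elim0, by simp⟩
    · obtain ⟨P, hP, l, hl⟩ := hcov x hx m hm
      refine ⟨F x P, Or.inr (Set.mem_biUnion hx ⟨P, hP, rfl⟩), ?_⟩
      refine mem_patternSet_cons.2 ⟨k, fun i => k + l i, ?_⟩
      have hsum : ∑ i, (p : ℤ) ^ x.1 * P.2.2 i * ((p : ℤ) ^ E) ^ (k + l i) =
          p ^ x.1 * ((p : ℤ) ^ E) ^ k * ∑ i, P.2.2 i * ((p : ℤ) ^ E) ^ l i := by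
        rw [Finset.mul_sum]
        exact Finset.sum_congr rfl fun i _ => by rw [pow_add]; ring
      rw [hsum, hk]
      linear_combination (p : ℤ) ^ x.1 * ((p : ℤ) ^ E) ^ k * hl

/-- The zeros of a subspace from a finite family that is stable under pulling back are covered by
patterns: after boundedly many digits the subspace becomes periodic. -/
theorem coveredByPatterns_of_mem [Fintype ι] [Nonempty ι] (hα : ∀ i, α i ≠ 0)
    (hαα : ∀ n : ℕ, 0 < n → Function.Injective fun i => α i ^ n)
    {𝒮 : Set (Submodule L (ι → L))} (hfin : 𝒮.Finite)
    (hclosed : ∀ V ∈ 𝒮, ∀ r < p, frobPull p α 1 r V ∈ 𝒮)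
    {V : Submodule L (ι → L)} (hVS : V ∈ 𝒮) (hVtop : V ≠ ⊤) :
    ∃ E : ℕ, 1 ≤ E ∧ CoveredByPatterns ((p : ℤ) ^ E) (Module.finrank L V) (zeros α V) := by
  obtain ⟨N, E, hE, hper⟩ := exists_isPeriodic hfin hclosed
  refine ⟨E, hE, ?_⟩
  let s : Set (ℕ × ℕ) := {x | x.1 ≤ N ∧ x.2 < p ^ N ∧ frobPull p α x.1 x.2 V ∈ 𝒮 ∧
    IsPeriodic p α E (frobPull p α x.1 x.2 V)}
  have hs : s.Finite := ((Set.finite_Iic N).prod (Set.finite_Iio (p ^ N))).subset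
    fun x hx => ⟨hx.1, hx.2.1⟩
  have hcov : ∀ x ∈ s, CoveredByPatterns ((p : ℤ) ^ E)
      (Module.finrank L (frobPull p α x.1 x.2 V)) (zeros α (frobPull p α x.1 x.2 V)) := by
    rintro x ⟨-, -, hx1, hx2⟩
    refine coveredByPatterns_of_isPeriodic hα hαα hclosed hE hper hx1 hx2 fun htop => hVtop ?_
    refine Submodule.eq_top_of_finrank_eq (le_antisymm (Submodule.finrank_le V) ?_)
    have := finrank_frobPull_le (p := p) hα x.1 x.2 V
    rwa [htop, finrank_top] at this
  choose! 𝒬 hQfin hsub hcov using hcov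
  let F : ℕ × ℕ → (Σ j, ℤ × (Fin j → ℤ)) → Σ j, ℤ × (Fin j → ℤ) := fun x P =>
    ⟨P.1, ((p : ℤ) ^ E - 1) * x.2 + p ^ x.1 * P.2.1, fun i => p ^ x.1 * P.2.2 i⟩
  have hsum : ∀ (x : ℕ × ℕ) (P : Σ j, ℤ × (Fin j → ℤ)) (l : Fin P.1 → ℕ),
      ∑ i, (p : ℤ) ^ x.1 * P.2.2 i * ((p : ℤ) ^ E) ^ l i =
        p ^ x.1 * ∑ i, P.2.2 i * ((p : ℤ) ^ E) ^ l i := fun x P l => by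
    rw [Finset.mul_sum]
    exact Finset.sum_congr rfl fun i _ => mul_assoc _ _ _
  refine ⟨⋃ x ∈ s, F x '' 𝒬 x, hs.biUnion fun x hx => (hQfin x hx).image _, ?_, ?_⟩
  · intro P hP
    simp only [Set.mem_iUnion] at hP
    obtain ⟨x, hx, P, hP, rfl⟩ := hP
    obtain ⟨hlt, hP⟩ := hsub x hx P hP
    refine ⟨hlt.trans_le (finrank_frobPull_le hα _ _ V), ?_⟩
    rintro n ⟨l, hl⟩
    change _ = ((p : ℤ) ^ E - 1) * x.2 + p ^ x.1 * P.2.1 +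
      ∑ i, (p : ℤ) ^ x.1 * P.2.2 i * ((p : ℤ) ^ E) ^ l i at hl
    rw [hsum] at hl
    obtain ⟨n', hn'⟩ : ((p : ℤ) ^ E - 1) ∣ P.2.1 + ∑ i, P.2.2 i * ((p : ℤ) ^ E) ^ l i := by
      refine (isCoprime_pow_sub_one_pow p hE x.1).dvd_of_dvd_mul_left ⟨n - x.2, ?_⟩
      linear_combination -hl
    have hq : ((p : ℤ) ^ E - 1) ≠ 0 := sub_ne_zero.2 (by
      exact_mod_cast (Nat.one_lt_pow (by omega) (Fact.out : p.Prime).one_lt).ne')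
    have hn : n = x.2 + p ^ x.1 * n' := by
      refine mul_left_cancel₀ hq ?_
      linear_combination hl + (p : ℤ) ^ x.1 * hn'
    rw [hn]
    exact (mem_zeros_frobPull hα).1 (hP ⟨l, hn'.symm⟩)
  · intro n hn
    obtain ⟨i, hi, hU⟩ := hper V hVS n
    have hdecomp : (n : ℤ) = (n % p ^ i : ℕ) + (p : ℤ) ^ i * ((n / p ^ i : ℕ) : ℤ) := by
      exact_mod_cast (Nat.mod_add_div _ _).symm
    have hx : ((i, n % p ^ i) : ℕ × ℕ) ∈ s := ⟨hi,
      (Nat.mod_lt _ (pow_pos (Fact.out : p.Prime).pos _)).trans_le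
        (Nat.pow_le_pow_right (Fact.out : p.Prime).pos hi), frobPull_mem hclosed hVS _ _, hU⟩
    have hm : ((n / p ^ i : ℕ) : ℤ) ∈ zeros α (frobPull p α i (n % p ^ i) V) := by
      rw [mem_zeros_frobPull hα, ← hdecomp]
      exact hn
    obtain ⟨P, hP, l, hl⟩ := hcov _ hx _ hm
    refine ⟨F (i, n % p ^ i) P, Set.mem_biUnion hx ⟨P, hP, rfl⟩, l, ?_⟩
    change _ = ((p : ℤ) ^ E - 1) * ((n % p ^ i : ℕ) : ℤ) + p ^ i * P.2.1 +
      ∑ a, (p : ℤ) ^ i * P.2.2 a * ((p : ℤ) ^ E) ^ l a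
    rw [hsum (i, n % p ^ i) P l, hdecomp]
    linear_combination (p : ℤ) ^ i * hl

end Patterns

/-! ### From patterns to nested sets -/

section Nested

theorem IsPNestedOfOrderLE.of_finite (p : ℕ) (D : ℤ) {A : Set ℕ} (hA : A.Finite) :
    IsPNestedOfOrderLE p D A :=
  ⟨A, ∅, hA, Set.finite_empty, by simp, by simp⟩

theorem IsPNestedOfOrderLE.biUnion {p : ℕ} {D : ℤ} {κ : Type*} {s : Set κ} (hs : s.Finite)
    {A : κ → Set ℕ} (hA : ∀ x ∈ s, IsPNestedOfOrderLE p D (A x)) :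
    IsPNestedOfOrderLE p D (⋃ x ∈ s, A x) := by
  choose! F C hF hC hCr hFC using hA
  refine ⟨⋃ x ∈ s, F x, ⋃ x ∈ s, C x, hs.biUnion hF, hs.biUnion hC, ?_, ?_⟩
  · intro B hB
    simp only [Set.mem_iUnion] at hB
    obtain ⟨x, hx, hB⟩ := hB
    exact hCr x hx B hB
  · rw [Set.iUnion₂_congr hFC]
    ext n
    simp only [Set.mem_iUnion, Set.mem_union, Set.mem_sUnion]
    constructor
    · rintro ⟨x, hx, h | ⟨B, hB, hn⟩⟩
      · exact Or.inl ⟨x, hx, h⟩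
      · exact Or.inr ⟨B, ⟨x, hx, hB⟩, hn⟩
    · rintro (⟨x, hx, h⟩ | ⟨B, ⟨x, hx, hB⟩, hn⟩)
      · exact ⟨x, hx, Or.inl h⟩
      · exact ⟨x, hx, Or.inr ⟨B, hB, hn⟩⟩

/-- Dividing coefficients by `q - 1`, a pattern set becomes a `p`-nested set, once vanishing
coefficients are dropped. -/
theorem isPNestedOfOrderLE_patternSet {p : ℕ} (hp : p.Prime) {E : ℕ} (hE : 1 ≤ E) {D : ℤ} {j : ℕ}
    (hj : (j : ℤ) ≤ D) (b₀ : ℤ) (b : Fin j → ℤ) :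
    IsPNestedOfOrderLE p D {n | (n : ℤ) ∈ patternSet ((p : ℤ) ^ E) b₀ b} := by
  have hqN : 1 < p ^ E := Nat.one_lt_pow (by omega) hp.one_lt
  have hq : (1 : ℤ) < (p : ℤ) ^ E := by exact_mod_cast hqN
  induction j with
  | zero =>
    refine .of_finite p D (Set.Finite.subset (Set.finite_Iic b₀.toNat) ?_)
    rintro n ⟨k, hk⟩
    simp only [Finset.univ_eq_empty, Finset.sum_empty, add_zero] at hk
    have : (n : ℤ) ≤ b₀ := by nlinarith
    simp only [Set.mem_Iic]
    omega
  | succ j ih =>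
  by_cases hzero : ∃ i, b i = 0
  · obtain ⟨i, hi⟩ := hzero
    convert ih (by push_cast at hj; omega) (fun a => b (i.succAbove a)) using 2
    ext n
    constructor
    · rintro ⟨k, hk⟩
      refine ⟨fun a => k (i.succAbove a), ?_⟩
      rwa [Fin.sum_univ_succAbove _ i, hi, zero_mul, zero_add] at hk
    · rintro ⟨k, hk⟩
      refine ⟨i.insertNth 0 k, ?_⟩
      rw [Fin.sum_univ_succAbove _ i, hi, zero_mul, zero_add]
      simpa using hk
  push Not at hzero
  by_cases hpos : ∃ i, 0 < b i
  swap
  · push Not at hpos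
    refine .of_finite p D (Set.Finite.subset (Set.finite_Iic b₀.toNat) ?_)
    rintro n ⟨k, hk⟩
    have hs : ∑ i, b i * ((p : ℤ) ^ E) ^ k i ≤ 0 :=
      Finset.sum_nonpos fun i _ => mul_nonpos_of_nonpos_of_nonneg (hpos i) (by positivity)
    have : (n : ℤ) ≤ b₀ := by nlinarith
    simp only [Set.mem_Iic]
    omega
  by_cases hne : Set.Nonempty {n : ℕ | (n : ℤ) ∈ patternSet ((p : ℤ) ^ E) b₀ b}
  swap
  · exact .of_finite p D (by rw [Set.not_nonempty_iff_eq_empty.1 hne]; exact Set.finite_empty)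
  have hqQ : ((p : ℚ) ^ E - 1) ≠ 0 := sub_ne_zero.2 (by exact_mod_cast hqN.ne')
  have hqQ' : 0 < ((p : ℚ) ^ E - 1) := sub_pos.2 (by exact_mod_cast hqN)
  have hsum : ∀ k : Fin (j + 1) → ℕ, (b₀ : ℚ) / ((p : ℚ) ^ E - 1) +
      ∑ i, (b i : ℚ) / ((p : ℚ) ^ E - 1) * ((p : ℚ) ^ E) ^ k i =
      ((b₀ + ∑ i, b i * ((p : ℤ) ^ E) ^ k i : ℤ) : ℚ) / ((p : ℚ) ^ E - 1) := fun k => by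
    push_cast
    rw [add_div, Finset.sum_div]
    congr 1
    exact Finset.sum_congr rfl fun i _ => by ring
  refine ⟨∅, {{n : ℕ | (n : ℤ) ∈ patternSet ((p : ℤ) ^ E) b₀ b}}, Set.finite_empty,
    Set.finite_singleton _, ?_, by simp⟩
  rintro _ rfl
  refine ⟨j + 1, hj, Nat.le_add_left 1 j, E, hE, b₀ / ((p : ℚ) ^ E - 1),
    fun i => b i / ((p : ℚ) ^ E - 1), ⟨?_, ?_, ?_, ?_⟩, ?_, ?_⟩
  · exact ⟨b₀, by push_cast; field_simp⟩
  · exact fun i => ⟨b i, by push_cast; field_simp⟩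
  · obtain ⟨n, k, hk⟩ := hne
    have hdvd : (p : ℤ) ^ E - 1 ∣ b₀ + ∑ i, b i * ((p : ℤ) ^ E) ^ (0 : ℕ) := by
      rw [dvd_add_sum_iff (l := fun _ => 0), ← dvd_add_sum_iff (l := k), ← hk]
      exact dvd_mul_right _ _
    obtain ⟨z, hz⟩ := hdvd
    refine ⟨z, ?_⟩
    have := hsum fun _ => 0
    rw [hz] at this
    push_cast at this
    rw [mul_div_cancel_left₀ _ hqQ] at this
    simpa using this
  · exact fun i => div_ne_zero (by exact_mod_cast hzero i) hqQ
  · obtain ⟨i, hi⟩ := hpos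
    exact ⟨i, div_pos (by exact_mod_cast hi) hqQ'⟩
  · ext n
    refine exists_congr fun k => ?_
    push_cast
    rw [hsum, eq_div_iff hqQ, mul_comm]
    rw [← @Int.cast_inj ℚ]
    push_cast
    rfl

end Nested

/-! ### Power sums -/

section PowerSums

/-- The zero set of a nondegenerate power sum with `d` terms is covered by patterns with at most
`d - 2` exponents. -/
theorem coveredByPatterns_powerSum {Ω : Type*} [Field Ω] {p : ℕ} [Fact p.Prime] [CharP Ω p]
    {ι : Type*} [Fintype ι] {α u : ι → Ω} (hα : ∀ i, α i ≠ 0)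
    (hαα : ∀ n : ℕ, 0 < n → Function.Injective fun i => α i ^ n) (hu : u ≠ 0) :
    ∃ E D : ℕ, 1 ≤ E ∧ D < Fintype.card ι ∧
      CoveredByPatterns ((p : ℤ) ^ E) D {n : ℤ | ∑ i, u i * α i ^ n = 0} := by
  classical
  obtain ⟨i₀, hi₀⟩ := Function.ne_iff.1 hu
  have : Nonempty ι := ⟨i₀⟩
  let := ZMod.algebra Ω p
  let g : ι ⊕ ι → Ω := Sum.elim α u
  -- the finitely generated field in which the argument takes place
  let L := IntermediateField.adjoin (ZMod p) (Set.range g)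
  let g' : ι ⊕ ι → L := fun x => ⟨g x, IntermediateField.subset_adjoin _ _ ⟨x, rfl⟩⟩
  have : CharP L p := (algebraMap L Ω).charP (algebraMap L Ω).injective p
  have hcoe : ∀ r : MvPolynomial (ι ⊕ ι) (ZMod p),
      ((MvPolynomial.aeval g' r : L) : Ω) = MvPolynomial.aeval g r := fun r =>
    (MvPolynomial.aeval_algebraMap_apply Ω g' r).symm
  have hgen : ∀ x : L, ∃ r s : MvPolynomial (ι ⊕ ι) (ZMod p),
      x = MvPolynomial.aeval g' r / MvPolynomial.aeval g' s := by
    rintro ⟨x, hx⟩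
    obtain ⟨r, s, h⟩ := (IntermediateField.mem_adjoin_range_iff _ _ _).1 hx
    refine ⟨r, s, Subtype.ext ?_⟩
    rw [IntermediateField.coe_div, hcoe, hcoe]
    exact h
  let α' : ι → L := fun i => g' (Sum.inl i)
  let u' : ι → L := fun i => g' (Sum.inr i)
  obtain ⟨𝒮, hfin, hmem, hclosed⟩ := exists_finite_stable_submodules hgen α' u'
    (fun i => ⟨_, rfl⟩) (fun i => ⟨_, rfl⟩)
  have hα' : ∀ i, α' i ≠ 0 := fun i h => hα i (congr_arg Subtype.val h)
  have hαα' : ∀ n : ℕ, 0 < n → Function.Injective fun i => α' i ^ n := fun n hn i j hij =>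
    hαα n hn (congr_arg Subtype.val hij)
  have htop : solutions {u'} ≠ ⊤ := by
    intro h
    have h1 : Pi.single i₀ 1 ∈ solutions {u'} := h ▸ Submodule.mem_top
    have h2 := mem_solutions.1 h1 u' rfl
    simp only [Pi.single_apply, mul_ite, mul_one, mul_zero, Finset.sum_ite_eq', Finset.mem_univ,
      if_true] at h2
    exact hi₀ (congr_arg Subtype.val h2)
  obtain ⟨E, hE, hcov⟩ := coveredByPatterns_of_mem hα' hαα' hfin hclosed hmem htop
  refine ⟨E, _, hE, by simpa using Submodule.finrank_lt htop, ?_⟩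
  convert hcov using 1
  ext n
  have hn : ((∑ i, u' i * α' i ^ n : L) : Ω) = ∑ i, u i * α i ^ n := by
    rw [IntermediateField.coe_sum]
    rfl
  simp only [mem_zeros, mem_solutions, Set.mem_singleton_iff, forall_eq, Set.mem_ofPred_eq]
  rw [← hn]
  exact ZeroMemClass.coe_eq_zero

theorem shift_pow_apply {K : Type*} [Field K] (a : ℕ → K) (k n : ℕ) :
    ((shift K) ^ k) a n = a (n + k) := by
  induction k generalizing n with
  | zero => rfl
  | succ k ih =>
    rw [pow_succ', Module.End.mul_apply]
    change ((shift K) ^ k) a (n + 1) = _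
    rw [ih, add_right_comm, add_assoc]

theorem aeval_shift_apply {K : Type*} [Field K] (P : K[X]) (a : ℕ → K) (n : ℕ) :
    aeval (shift K) P a n = P.sum fun k c => c * a (n + k) := by
  rw [aeval_eq_sum_range, sum_over_range _ (by simp)]
  simp [LinearMap.sum_apply, Finset.sum_apply, shift_pow_apply]

theorem exists_eq_powerSum {K : Type*} [Field K] (s : Finset K) (a : ℕ → K)
    (h : aeval (shift K) (∏ x ∈ s, (X - C x)) a = 0) :
    ∃ u : K → K, ∀ n, a n = ∑ x ∈ s, u x * x ^ n := by
  classical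
  induction s using Finset.induction_on generalizing a with
  | empty => exact ⟨0, fun n => by simpa using congr_fun h n⟩
  | insert x s hx ih =>
    rw [Finset.prod_insert hx, ← LinearMap.mem_ker,
      ← sup_ker_aeval_eq_ker_aeval_mul_of_coprime] at h
    · obtain ⟨y, hy, z, hz, rfl⟩ := Submodule.mem_sup.1 h
      obtain ⟨u, hu⟩ := ih z (LinearMap.mem_ker.1 hz)
      have hyn : ∀ n, y n = y 0 * x ^ n := by
        intro n
        induction n with
        | zero => simp
        | succ n ihn =>
          have := congr_fun (LinearMap.mem_ker.1 hy) n
          simp only [map_sub, aeval_X, aeval_C, LinearMap.sub_apply, Pi.sub_apply,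
            Module.algebraMap_end_apply, Pi.smul_apply, smul_eq_mul, Pi.zero_apply] at this
          change y (n + 1) - x * y n = 0 at this
          rw [sub_eq_zero.1 this, ihn]
          ring
      refine ⟨Function.update u x (y 0), fun n => ?_⟩
      rw [Finset.sum_insert hx, Function.update_self, Pi.add_apply, hyn, hu]
      congr 1
      refine Finset.sum_congr rfl fun w hw => ?_
      rw [Function.update_of_ne (ne_of_mem_of_not_mem hw hx)]
    · refine IsCoprime.prod_right fun w hw => ?_
      exact pairwise_coprime_X_sub_C Function.injective_id (ne_of_mem_of_not_mem hw hx).symm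

end PowerSums

/-! ### Power sum expansion of a simple sequence -/

section Main

theorem SatisfiesRecurrence.exists_monic {K : Type*} [Field K] {a : ℕ → K} {d : ℕ}
    (h : SatisfiesRecurrence a d) :
    ∃ P : K[X], P.Monic ∧ P.natDegree = d ∧ aeval (shift K) P a = 0 := by
  obtain ⟨R, rfl, hR⟩ := h
  refine ⟨R.charPoly, R.charPoly_monic, ?_, ?_⟩
  · exact natDegree_eq_of_degree_eq_some R.charPoly_degree_eq_order
  · funext n
    have := hR n
    simp [LinearRecurrence.charPoly, LinearMap.sum_apply, aeval_monomial, Finset.sum_apply,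
      shift_pow_apply, this]

/-- The power sum expansion of a simple recurrence sequence of order `d` over the algebraic
closure; there are at most `d` terms. -/
theorem exists_powerSum_of_isSimple {K : Type*} [Field K] {a : ℕ → K} {d : ℕ}
    (hd : SatisfiesRecurrence a d) (hsimple : IsSimple a) :
    ∃ (s : Finset (AlgebraicClosure K)) (u : AlgebraicClosure K → AlgebraicClosure K),
      s.card ≤ d ∧ (∀ x ∈ s, aeval x (minPolynomial a) = 0) ∧
      ∀ n, algebraMap K _ (a n) = ∑ x ∈ s, u x * x ^ n := by
  classical
  obtain ⟨Q, hQ, hQd, hQa⟩ := hd.exists_monic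
  have hdvd : minPolynomial a ∣ Q := (minPolynomial_dvd_iff a Q).2 hQa
  have hP0 : minPolynomial a ≠ 0 := fun h => hQ.ne_zero (zero_dvd_iff.1 (h ▸ hdvd))
  have hPm : (minPolynomial a).Monic := minPolynomial_monic a fun h => hQ.ne_zero (by
    have : Q ∈ annIdeal a := hQa
    rwa [h, Ideal.mem_bot] at this)
  have hPa : aeval (shift K) (minPolynomial a) a = 0 := (minPolynomial_dvd_iff a _).1 dvd_rfl
  let s := ((minPolynomial a).aroots (AlgebraicClosure K)).toFinset
  have hprod : (minPolynomial a).map (algebraMap K (AlgebraicClosure K)) = ∏ x ∈ s, (X - C x) := by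
    have h1 := (IsAlgClosed.splits
      ((minPolynomial a).map (algebraMap K (AlgebraicClosure K)))).eq_prod_roots
    rw [(hPm.map _).leadingCoeff, C_1, one_mul] at h1
    rw [h1, Finset.prod_eq_multiset_prod, Multiset.toFinset_val, Multiset.dedup_eq_self.2 hsimple]
  have hzero : aeval (shift (AlgebraicClosure K)) (∏ x ∈ s, (X - C x))
      (fun n => algebraMap K (AlgebraicClosure K) (a n)) = 0 := by
    funext n
    have h1 := congr_arg (algebraMap K (AlgebraicClosure K)) (congr_fun hPa n)
    rw [aeval_shift_apply, Polynomial.sum_def, map_sum] at h1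
    rw [← hprod, aeval_shift_apply, Polynomial.sum_def,
      support_map_of_injective _ (algebraMap K (AlgebraicClosure K)).injective]
    simpa using h1
  obtain ⟨u, hu⟩ := exists_eq_powerSum s _ hzero
  refine ⟨s, u, ?_, fun x hx => ?_, hu⟩
  · calc s.card ≤ _ := Multiset.toFinset_card_le _
      _ ≤ _ := card_roots' _
      _ = (minPolynomial a).natDegree := natDegree_map _
      _ ≤ Q.natDegree := natDegree_le_of_dvd hdvd hQ.ne_zero
      _ = d := hQd
  · exact ((mem_aroots.1 (Multiset.mem_toFinset.1 hx))).2

end Main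

end SkolemMahlerLech

theorem theorem2p7 {K : Type*} [Field K] (p : ℕ) (hp : p.Prime) [CharP K p]
    (a : ℕ → K) (d : ℕ) (ha : a ≠ 0)
    (hd : SkolemMahlerLech.IsRecurrenceSeqOfOrder a d)
    (hsimple : SkolemMahlerLech.IsSimple a)
    (hnondeg : SkolemMahlerLech.IsNondegenerate a) :
    SkolemMahlerLech.IsPNestedOfOrderLE p ((d : ℤ) - 2) (SkolemMahlerLech.zeroSet a) ∧
      ∀ A : Set ℕ, SkolemMahlerLech.IsInfiniteAP A → ¬ A ⊆ SkolemMahlerLech.zeroSet a := by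
  have : Fact p.Prime := ⟨hp⟩
  have : CharP (AlgebraicClosure K) p :=
    charP_of_injective_algebraMap (algebraMap K (AlgebraicClosure K)).injective p
  obtain ⟨s, u, hs, hroot, hu⟩ := SkolemMahlerLech.exists_powerSum_of_isSimple hd.1 hsimple
  have hzero : ∀ n, n ∈ SkolemMahlerLech.zeroSet a ↔
      ∑ x : s, u x * (x : AlgebraicClosure K) ^ n = 0 := by
    intro n
    rw [Finset.sum_coe_sort s fun x => u x * x ^ n, ← hu]
    exact (map_eq_zero _).symm
  have hα : ∀ x : s, (x : AlgebraicClosure K) ≠ 0 := fun x => hnondeg.1 x (hroot x x.2)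
  have hαα : ∀ n : ℕ, 0 < n → Function.Injective fun x : s => (x : AlgebraicClosure K) ^ n := by
    intro n hn x y hxy
    by_contra hne
    refine hnondeg.2 x y (hroot x x.2) (hroot y y.2) (fun h => hne (Subtype.ext h)) n hn ?_
    rw [div_pow, div_eq_one_iff_eq (pow_ne_zero n (hα y))]
    exact hxy
  have hu0 : (fun x : s => u x) ≠ 0 := by
    intro h0
    apply ha
    funext n
    refine (hzero n).2 (Finset.sum_eq_zero fun x _ => ?_)
    rw [show u x = 0 from congr_fun h0 x, zero_mul]
  constructor
  · obtain ⟨E, D, hE, hD, 𝒬, hfin, hsub, hcov⟩ :=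
      SkolemMahlerLech.coveredByPatterns_powerSum (p := p) hα hαα hu0
    rw [Fintype.card_coe] at hD
    have hset : SkolemMahlerLech.zeroSet a =
        ⋃ P ∈ 𝒬, {n : ℕ | (n : ℤ) ∈ SkolemMahlerLech.patternSet ((p : ℤ) ^ E) P.2.1 P.2.2} := by
      ext n
      simp only [Set.mem_iUnion, exists_prop, hzero]
      constructor
      · intro h
        exact hcov n (by simpa using h)
      · rintro ⟨P, hP, hn⟩
        simpa using (hsub P hP).2 hn
    rw [hset]
    refine SkolemMahlerLech.IsPNestedOfOrderLE.biUnion hfin fun P hP =>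
      SkolemMahlerLech.isPNestedOfOrderLE_patternSet hp hE ?_ _ _
    have := (hsub P hP).1
    omega
  · rintro _ ⟨m, n, hn, rfl⟩ hsub
    have h0 : (fun x : s => u x * (x : AlgebraicClosure K) ^ m) = 0 :=
      SkolemMahlerLech.eq_zero_of_forall_sum_mul_pow_eq_zero (hαα n hn) fun k => by
        have h1 := (hzero _).1 (hsub ⟨k, rfl⟩)
        simpa [pow_add, pow_mul, mul_assoc] using h1
    refine hu0 (funext fun x => ?_)
    exact (mul_eq_zero.1 (congr_fun h0 x)).resolve_right (pow_ne_zero m (hα x))
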